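/- Let $n\ge 0$ and let $F,G:\mathbb{R}^n\to\mathbb{R}\cup\{+\infty\}$ be convex functions with effective domains $\operatorname{dom}F=\{x: F(x)<+\infty\}$ and $\operatorname{dom}G$, such that $\operatorname{ri}(\operatorname{dom}F)\cap\operatorname{ri}(\operatorname{dom}G)\neq\emptyset$. Let $P[F]=\{p\in\mathbb{R}^n: F(x+p)=F(x)\text{ for all }x\in\mathbb{R}^n\}$ be the space of periods of $F$. Suppose that there is a direct decomposition $$\operatorname{aff}(\operatorname{dom}F)=\check A\oplus\check P$$ (every element of $\operatorname{aff}(\operatorname{dom}F)$ is uniquely $a+p$ with $a\in\check A$, $p\in\check P$, and all such sums lie in $\operatorname{aff}(\operatorname{dom}F)$) into an affine subspace $\check A\subseteq\mathbb{R}^n$ and a vector subspace $\check P\subseteq P[F]$ such that 1. $F$ is essentially smooth on $\operatorname{aff}(\operatorname{dom}F)$ or on $\check A$; 2. $F$ is strictly convex on $\operatorname{int}_{\check A}(\operatorname{dom}F|_{\check A})$, the interior of $\check A\cap\operatorname{dom}F$ relative to $\check A$. Here $F$ is called essentially smooth on an affine subspace $A$ if $\operatorname{int}_A(\operatorname{dom}F|_A)\ne\emptyset$,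 $F|_A$ is differentiable at every point of $\operatorname{int}_A(\operatorname{dom}F|_A)$, and $\|D(F|_A)(x_k)\|\to+\infty$ for every sequence $(x_k)$ in $\operatorname{int}_A(\operatorname{dom}F|_A)$ that converges to a point of the boundary of $\operatorname{dom}F|_A$ relative to $A$. Then $$\operatorname{argmin}_{x\in\mathbb{R}^n}(F(x)+G(x))\subseteq\operatorname{ri}(\operatorname{dom}F),$$ and for all $\hat x,\tilde x\in\operatorname{argmin}_{x\in\mathbb{R}^n}(F(x)+G(x))$ one has $$\hat x-\tilde x\in\check P,\qquad F(\hat x)=F(\tilde x),\qquad G(\hat x)=G(\tilde x).$$ -/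

import Mathlib

open Set Filter Topology

/-! Extended-real-valued convex functions. A function into `ℝ ∪ {+∞}` is a function into `EReal`
that never takes the value `⊥`. -/

namespace ConvexArgmin

section

variable {E : Type*} [NormedAddCommGroup E] [NormedSpace ℝ E]

/-- The effective domain `{x | F x < +∞}`. -/
def effDom (F : E → EReal) : Set E := {x | F x < ⊤}

/-- `F` is a convex function from the whole space into `ℝ ∪ {+∞}`. -/
def IsConvexFun (F : E → EReal) : Prop :=
  (∀ x, F x ≠ ⊥) ∧
    ∀ x y : E, ∀ a b : ℝ, 0 < a → 0 < b → a + b = 1 →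
      F (a • x + b • y) ≤ (a : EReal) * F x + (b : EReal) * F y

/-- Strict convexity on `S`, for a function into `ℝ ∪ {+∞}` that is finite on the convex
set `S`. -/
def IsStrictlyConvexOn (F : E → EReal) (S : Set E) : Prop :=
  ∀ x ∈ S, ∀ y ∈ S, x ≠ y → ∀ a b : ℝ, 0 < a → 0 < b → a + b = 1 →
    F (a • x + b • y) < (a : EReal) * F x + (b : EReal) * F y

/-- The set `P[F]` of all periods of `F`. -/
def periods (F : E → EReal) : Set E := {p | ∀ x, F (x + p) = F x}

/-- The interior of `S ∩ A` relative to the affine subspace `A`. For `A = affineSpan ℝ S` this is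
`intrinsicInterior ℝ S`. -/
def relInterior (A : AffineSubspace ℝ E) (S : Set E) : Set E :=
  ((↑) : A → E) '' interior ((↑) ⁻¹' S)

/-- The boundary of `S ∩ A` relative to the affine subspace `A`. -/
def relBoundary (A : AffineSubspace ℝ E) (S : Set E) : Set E :=
  ((↑) : A → E) '' frontier ((↑) ⁻¹' S)

/-- The restriction of `F` to the affine subspace `A`, seen from the base point `x ∈ A` as a
function of the displacement `h` in the direction space of `A`. It is only used at points `x`
around which `F` is finite on `A`, so that `EReal.toReal` does not change the values
near `h = 0`. -/
noncomputable def localRestriction (F : E → EReal) (A : AffineSubspace ℝ E) (x : E) :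
    A.direction → ℝ :=
  fun h => (F (x + (h : E))).toReal

/-- `F` is essentially smooth on the affine subspace `A`: the domain of `F|_A` has nonempty
interior in `A`, `F|_A` is differentiable there, and the norms of the derivatives tend to `+∞`
along every sequence of such interior points that converges to a boundary point (relative
to `A`) of the domain. -/
def EssentiallySmoothOn (F : E → EReal) (A : AffineSubspace ℝ E) : Prop :=
  (relInterior A (effDom F)).Nonempty ∧
    (∀ x ∈ relInterior A (effDom F), DifferentiableAt ℝ (localRestriction F A x) 0) ∧
    ∀ (u : ℕ → E) (x : E), (∀ k, u k ∈ relInterior A (effDom F)) →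
      x ∈ relBoundary A (effDom F) → Tendsto u atTop (𝓝 x) →
        Tendsto (fun k => ‖fderiv ℝ (localRestriction F A (u k)) 0‖) atTop atTop

/-- `S = S₁ ⊕ S₂` for sets: `S = S₁ + S₂`, and each element of `S` is in only one way a sum of an
element of `S₁` and one of `S₂`. -/
def IsDirectSum (S S₁ S₂ : Set E) : Prop :=
  BijOn (fun q : E × E => q.1 + q.2) (S₁ ×ˢ S₂) S

/-- The set of global minimizers of `H`. -/
def argmin (H : E → EReal) : Set E := {x | ∀ y, H x ≤ H y}

end

end ConvexArgmin

namespace ConvexArgmin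

section

variable {E : Type*} [NormedAddCommGroup E] [NormedSpace ℝ E]

/-! Join a minimizer `x` to a point `z` of both relative interiors. Along the segment, minimality
says that `F` drops by no more than `G` rises, and convexity bounds that rise linearly. If `x` were
a relative boundary point, the derivatives would blow up on approach to it, while subgradient
inequalities tested at `x` and around `z` keep them bounded (`EssentiallySmoothOn.mem_relInterior`).
Moving along `P` changes neither `F` nor relative interiority, so this can be carried out in `A`. If
two minimizers had different `A`-components, strict convexity would make their midpoint better. So
they differ by an element of `P`; the `F`-values agree, hence the `G`-values too. -/

theorem mem_relInterior_iff {A : AffineSubspace ℝ E} {S : Set E} {x : E} :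
    x ∈ relInterior A S ↔
      x ∈ A ∧ ∃ r > 0, ∀ v ∈ A.direction, ‖v‖ < r → x + v ∈ S := by
  constructor
  · rintro ⟨⟨x, hx⟩, hxi, rfl⟩
    refine ⟨hx, ?_⟩
    rw [mem_interior_iff_mem_nhds, Metric.mem_nhds_iff] at hxi
    obtain ⟨r, hr, hball⟩ := hxi
    refine ⟨r, hr, fun v hv hvr => ?_⟩
    have hmem : x + v ∈ A := by
      simpa [add_comm] using AffineSubspace.vadd_mem_of_mem_direction hv hx
    refine @hball ⟨x + v, hmem⟩ ?_
    simpa [Metric.mem_ball, Subtype.dist_eq, dist_eq_norm] using hvr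
  · rintro ⟨hx, r, hr, h⟩
    refine ⟨⟨x, hx⟩, ?_, rfl⟩
    rw [mem_interior_iff_mem_nhds, Metric.mem_nhds_iff]
    refine ⟨r, hr, ?_⟩
    rintro ⟨y, hy⟩ hyr
    have hv : y - x ∈ A.direction := by
      simpa using AffineSubspace.vsub_mem_direction hy hx
    have := h (y - x) hv (by
      simpa [Metric.mem_ball, Subtype.dist_eq, dist_eq_norm] using hyr)
    simpa using this

theorem mem_relBoundary_of_notMem_relInterior {A : AffineSubspace ℝ E} {S : Set E} {x : E}
    (hx : x ∈ A) (hxS : x ∈ S) (h : x ∉ relInterior A S) : x ∈ relBoundary A S :=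
  ⟨⟨x, hx⟩, ⟨subset_closure hxS, fun hi => h ⟨_, hi, rfl⟩⟩, rfl⟩

theorem IsConvexFun.coe_toReal {F : E → EReal} (hF : IsConvexFun F) {x : E}
    (hx : x ∈ effDom F) : ((F x).toReal : EReal) = F x :=
  EReal.coe_toReal (ne_of_lt hx) (hF.1 x)

theorem IsConvexFun.combo {F : E → EReal} (hF : IsConvexFun F) {x y : E}
    (hx : x ∈ effDom F) (hy : y ∈ effDom F) {a b : ℝ} (ha : 0 < a) (hb : 0 < b)
    (hab : a + b = 1) :
    a • x + b • y ∈ effDom F ∧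
      (F (a • x + b • y)).toReal ≤ a * (F x).toReal + b * (F y).toReal := by
  have h := hF.2 x y a b ha hb hab
  rw [← hF.coe_toReal hx, ← hF.coe_toReal hy] at h
  have h' : F (a • x + b • y) ≤ ((a * (F x).toReal + b * (F y).toReal : ℝ) : EReal) := by
    exact_mod_cast h
  have hd : a • x + b • y ∈ effDom F := lt_of_le_of_lt h' (EReal.coe_lt_top _)
  refine ⟨hd, ?_⟩
  rw [← hF.coe_toReal hd] at h'
  exact_mod_cast h'

theorem IsConvexFun.combo_mem_relInterior {F : E → EReal} (hF : IsConvexFun F)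
    {A : AffineSubspace ℝ E} {x z : E} (hxA : x ∈ A) (hx : x ∈ effDom F)
    (hz : z ∈ relInterior A (effDom F)) {t : ℝ} (ht : 0 < t) (ht1 : t ≤ 1) :
    x + t • (z - x) ∈ relInterior A (effDom F) := by
  rw [mem_relInterior_iff] at hz ⊢
  obtain ⟨hzA, r, hr, h⟩ := hz
  have hdir : z - x ∈ A.direction := by
    simpa using AffineSubspace.vsub_mem_direction hzA hxA
  -- The homothety with centre `x` and ratio `t` maps the `r`-ball at `z` to the `t * r`-ball at the
  -- new point.
  refine ⟨?_, t * r, by positivity, fun v hv hvr => ?_⟩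
  · simpa [add_comm] using
      AffineSubspace.vadd_mem_of_mem_direction (A.direction.smul_mem t hdir) hxA
  have hmem : z + t⁻¹ • v ∈ effDom F := by
    refine h _ (A.direction.smul_mem _ hv) ?_
    rw [norm_smul, Real.norm_of_nonneg (by positivity), inv_mul_lt_iff₀ ht]
    exact hvr
  have heq : x + t • (z - x) + v = (1 - t) • x + t • (z + t⁻¹ • v) := by
    rw [smul_add, smul_inv_smul₀ ht.ne']
    module
  rw [heq]
  rcases ht1.eq_or_lt with rfl | hlt
  · simpa using hmem
  · exact (hF.combo hx hmem (by linarith) ht (by ring)).1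

/-- The subgradient inequality for the derivative of a convex function along an affine subspace. -/
theorem IsConvexFun.fderiv_localRestriction_le {F : E → EReal} (hF : IsConvexFun F)
    {A : AffineSubspace ℝ E} {x : E} (hx : x ∈ effDom F)
    (hd : DifferentiableAt ℝ (localRestriction F A x) 0) (h : A.direction)
    (hy : x + (h : E) ∈ effDom F) :
    (F x).toReal + fderiv ℝ (localRestriction F A x) 0 h ≤ (F (x + (h : E))).toReal := by
  have hline : HasDerivAt (fun t : ℝ => t • h) h 0 := by
    simpa using (hasDerivAt_id (0 : ℝ)).smul_const h
  have hfd : HasFDerivAt (localRestriction F A x) (fderiv ℝ (localRestriction F A x) 0)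
      ((fun t : ℝ => t • h) 0) := by
    simpa using hd.hasFDerivAt
  have hcomp : HasDerivAt (localRestriction F A x ∘ fun t : ℝ => t • h)
      (fderiv ℝ (localRestriction F A x) 0 h) 0 := hfd.comp_hasDerivAt 0 hline
  have hslope := (hasDerivAt_iff_tendsto_slope_zero.1 hcomp).mono_left
    (nhdsWithin_mono (0 : ℝ) (show Ioi (0 : ℝ) ⊆ {0}ᶜ from fun t ht => ne_of_gt ht))
  have hle : fderiv ℝ (localRestriction F A x) 0 h ≤ (F (x + (h : E))).toReal - (F x).toReal := by
    refine le_of_tendsto hslope ?_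
    filter_upwards [Ioo_mem_nhdsGT (zero_lt_one' ℝ)] with t ht
    have hc := (hF.combo hx hy (sub_pos.2 ht.2) ht.1 (by ring)).2
    have heq : (1 - t) • x + t • (x + (h : E)) = x + t • (h : E) := by module
    rw [heq] at hc
    simp only [localRestriction, Function.comp_apply, zero_add, zero_smul, smul_eq_mul,
      Submodule.coe_smul, Submodule.coe_zero, add_zero]
    rw [inv_mul_le_iff₀ ht.1]
    linarith
  linarith

/-- If a convex function that is essentially smooth on `A` decreases at most linearly from
`x ∈ A` towards a relative interior point of its domain, then `x` is itself such a point. -/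
theorem EssentiallySmoothOn.mem_relInterior [FiniteDimensional ℝ E] {F : E → EReal}
    (hF : IsConvexFun F) {A : AffineSubspace ℝ E} (hs : EssentiallySmoothOn F A) {x z : E}
    (hxA : x ∈ A) (hx : x ∈ effDom F) (hz : z ∈ relInterior A (effDom F)) (C : ℝ)
    (hC : ∀ t : ℝ, 0 < t → t ≤ 1 →
      (F x).toReal - t * C ≤ (F (x + t • (z - x))).toReal) :
    x ∈ relInterior A (effDom F) := by
  by_contra hnot
  have hzA := (mem_relInterior_iff.1 hz).1
  obtain ⟨r, hr, hball⟩ := (mem_relInterior_iff.1 hz).2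
  have hdir : z - x ∈ A.direction := by
    simpa using AffineSubspace.vsub_mem_direction hzA hxA
  set w : A.direction := ⟨z - x, hdir⟩ with hw
  set t : ℕ → ℝ := fun k => 1 / ((k : ℝ) + 1) with ht
  have ht0 : ∀ k, 0 < t k := fun k => by positivity
  have ht1 : ∀ k, t k ≤ 1 := fun k => by
    rw [ht, div_le_one (by positivity)]
    simp
  set u : ℕ → E := fun k => x + t k • (z - x) with hu
  have hui : ∀ k, u k ∈ relInterior A (effDom F) := fun k =>
    hF.combo_mem_relInterior hxA hx hz (ht0 k) (ht1 k)
  have hud : ∀ k, u k ∈ effDom F := fun k => by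
    obtain ⟨_, r, hr, h⟩ := mem_relInterior_iff.1 (hui k)
    simpa using h 0 (zero_mem _) (by simpa using hr)
  have hlim : Tendsto u atTop (𝓝 x) := by
    have : Tendsto (fun k => x + t k • (z - x)) atTop (𝓝 (x + (0 : ℝ) • (z - x))) :=
      (tendsto_one_div_add_atTop_nhds_zero_nat.smul_const _).const_add x
    simpa using this
  have htop := hs.2.2 u x hui (mem_relBoundary_of_notMem_relInterior hxA hx hnot) hlim
  set D : ℕ → A.direction →L[ℝ] ℝ := fun k => fderiv ℝ (localRestriction F A (u k)) 0 with hD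
  have hsub : ∀ k (h : A.direction), u k + (h : E) ∈ effDom F →
      (F (u k)).toReal + D k h ≤ (F (u k + (h : E))).toReal := fun k h hy =>
    hF.fderiv_localRestriction_le (hud k) (hs.2.1 _ (hui k)) h hy
  -- Lower bound towards `z`: the subgradient inequality at `u k` is tested at `x`.
  have hDw : ∀ k, -C ≤ D k w := fun k => by
    have heq : u k + ((-(t k) • w : A.direction) : E) = x := by
      simp [hu, hw]
    have h1 := hsub k (-(t k) • w) (by rw [heq]; exact hx)
    rw [heq, map_smul, smul_eq_mul] at h1
    have h2 := hC (t k) (ht0 k) (ht1 k)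
    have h3 : t k * (-C) ≤ t k * D k w := by
      change _ ≤ (F (u k)).toReal at h2
      linarith
    exact le_of_mul_le_mul_left h3 (ht0 k)
  -- Upper bound in direction `v`: the test point `z + s • v` does not depend on `k`, and `hDw`
  -- absorbs the part of the displacement along `w`. The errors `t k * C` and `(1 - t k) * C` are
  -- each at most `|C|`.
  have hbound : ∀ v : A.direction, ∃ M, ∀ k, D k v ≤ M := fun v => by
    obtain ⟨s, hs0, hsr⟩ : ∃ s : ℝ, 0 < s ∧ ‖s • v‖ < r := by
      refine ⟨r / (‖v‖ + 1), by positivity, ?_⟩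
      rw [norm_smul, Real.norm_of_nonneg (by positivity), div_mul_eq_mul_div,
        div_lt_iff₀ (by positivity)]
      nlinarith [norm_nonneg v]
    have hy : z + s • (v : E) ∈ effDom F := hball _ (A.direction.smul_mem s v.2) (by simpa using hsr)
    refine ⟨s⁻¹ * ((F (z + s • (v : E))).toReal - (F x).toReal + 2 * |C|), fun k => ?_⟩
    have heq : u k + (((1 - t k) • w + s • v : A.direction) : E) = z + s • (v : E) := by
      simp only [hu, hw, Submodule.coe_add, Submodule.coe_smul]
      module
    have h1 := hsub k ((1 - t k) • w + s • v) (by rw [heq]; exact hy)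
    rw [heq, map_add, map_smul, map_smul, smul_eq_mul, smul_eq_mul] at h1
    have h2 : (F x).toReal - t k * C ≤ (F (u k)).toReal := hC (t k) (ht0 k) (ht1 k)
    have h3 : (1 - t k) * (-C) ≤ (1 - t k) * D k w :=
      mul_le_mul_of_nonneg_left (hDw k) (by linarith [ht1 k])
    rw [le_inv_mul_iff₀ hs0]
    linarith [le_abs_self C, abs_nonneg C]
  -- Bounds at `v` and `-v` give pointwise boundedness, hence a uniform norm bound, against the
  -- blow-up.
  obtain ⟨M, hM⟩ : ∃ M, ∀ k, ‖D k‖ ≤ M := by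
    refine banach_steinhaus fun v => ?_
    obtain ⟨M₁, h₁⟩ := hbound v
    obtain ⟨M₂, h₂⟩ := hbound (-v)
    refine ⟨max M₁ M₂, fun k => ?_⟩
    have := h₂ k
    rw [map_neg] at this
    exact abs_le'.2 ⟨(h₁ k).trans (le_max_left _ _), this.trans (le_max_right _ _)⟩
  obtain ⟨k, hk⟩ := (htop.eventually (eventually_gt_atTop M)).exists
  exact absurd (hM k) (not_le.2 hk)

theorem IsDirectSum.direction_le {S : Set E} {A : AffineSubspace ℝ E} {P : Submodule ℝ E}
    (h : IsDirectSum S A P) {Q : AffineSubspace ℝ E} (hQ : (Q : Set E) = S) :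
    A.direction ≤ Q.direction := by
  intro v hv
  obtain hA | ⟨a, ha⟩ := (A : Set E).eq_empty_or_nonempty
  · rw [(AffineSubspace.coe_eq_bot_iff A).1 hA, AffineSubspace.direction_bot,
      Submodule.mem_bot] at hv
    simp [hv]
  have hsub : ∀ y ∈ A, y ∈ Q := fun y hy => by
    have := h.mapsTo (show (y, (0 : E)) ∈ (A : Set E) ×ˢ (P : Set E) from ⟨hy, P.zero_mem⟩)
    rw [← hQ] at this
    simpa using this
  exact AffineSubspace.direction_le hsub hv

/-- Adding a period that is complementary to `A` maps relative interior points in `A` of the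
domain to its intrinsic interior. -/
theorem add_mem_intrinsicInterior [FiniteDimensional ℝ E] {F : E → EReal}
    {A : AffineSubspace ℝ E} {P : Submodule ℝ E} (hP : (P : Set E) ⊆ periods F)
    (h : IsDirectSum (affineSpan ℝ (effDom F) : Set E) A P) {a p : E}
    (ha : a ∈ relInterior A (effDom F)) (hp : p ∈ P) :
    a + p ∈ intrinsicInterior ℝ (effDom F) := by
  change a + p ∈ relInterior (affineSpan ℝ (effDom F)) (effDom F)
  obtain ⟨haA, r, hr, hball⟩ := mem_relInterior_iff.1 ha
  have hapS : a + p ∈ affineSpan ℝ (effDom F) :=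
    h.mapsTo (show (a, p) ∈ (A : Set E) ×ˢ (P : Set E) from ⟨haA, hp⟩)
  refine mem_relInterior_iff.2 ⟨hapS, ?_⟩
  -- Uniqueness of the decomposition makes `L` injective, hence antilipschitz in finite dimension: a
  -- small displacement has a small `A`-component.
  let L : A.direction × P →ₗ[ℝ] E := A.direction.subtype.coprod P.subtype
  have hLinj : Function.Injective L := by
    rintro ⟨v, q⟩ ⟨v', q'⟩ hvq
    have hvq' : (v : E) + q = v' + q' := by simpa [L] using hvq
    have hmem : ∀ v : A.direction, a + (v : E) ∈ A := fun v => by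
      simpa [add_comm] using AffineSubspace.vadd_mem_of_mem_direction v.2 haA
    have := h.injOn (show (a + (v : E), (q : E)) ∈ (A : Set E) ×ˢ (P : Set E) from
      ⟨hmem v, q.2⟩) (show (a + (v' : E), (q' : E)) ∈ (A : Set E) ×ˢ (P : Set E) from
      ⟨hmem v', q'.2⟩) (by simp only [add_assoc, hvq'])
    simpa using this
  obtain ⟨K, hK, hanti⟩ := L.exists_antilipschitzWith (LinearMap.ker_eq_bot.2 hLinj)
  refine ⟨r / K, by positivity, fun v hv hvr => ?_⟩
  have hyS : a + p + v ∈ affineSpan ℝ (effDom F) := by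
    simpa [add_comm] using AffineSubspace.vadd_mem_of_mem_direction hv hapS
  obtain ⟨⟨b, q⟩, ⟨hb, hq⟩, hbq⟩ := h.surjOn hyS
  have hb' : b - a ∈ A.direction := by
    simpa using AffineSubspace.vsub_mem_direction hb haA
  have hnorm : ‖b - a‖ < r := by
    have h1 := hanti.le_mul_dist (⟨b - a, hb'⟩, ⟨q - p, P.sub_mem hq hp⟩) 0
    have h2 : L (⟨b - a, hb'⟩, ⟨q - p, P.sub_mem hq hp⟩) = v := by
      have : b + q = a + p + v := hbq
      simp only [L, LinearMap.coprod_apply, Submodule.subtype_apply]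
      rw [show b - a + (q - p) = b + q - (a + p) by abel, this]
      abel
    rw [h2, map_zero, dist_zero_right, dist_zero_right] at h1
    rw [lt_div_iff₀ (by positivity)] at hvr
    have h3 : ‖b - a‖ ≤ ‖((⟨b - a, hb'⟩, ⟨q - p, P.sub_mem hq hp⟩) : A.direction × P)‖ :=
      norm_fst_le ((⟨b - a, hb'⟩, ⟨q - p, P.sub_mem hq hp⟩) : A.direction × P)
    linarith
  have hbd := hball _ hb' hnorm
  rw [add_sub_cancel] at hbd
  change F (a + p + v) < ⊤
  rw [← hbq]
  change F (b + q) < ⊤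
  rw [hP hq b]
  exact hbd

theorem mem_relInterior_of_add_mem_intrinsicInterior {F : E → EReal}
    {A : AffineSubspace ℝ E} {P : Submodule ℝ E} (hP : (P : Set E) ⊆ periods F)
    (h : IsDirectSum (affineSpan ℝ (effDom F) : Set E) A P) {a p : E}
    (ha : a ∈ A) (hp : p ∈ P) (hap : a + p ∈ intrinsicInterior ℝ (effDom F)) :
    a ∈ relInterior A (effDom F) := by
  change a + p ∈ relInterior (affineSpan ℝ (effDom F)) (effDom F) at hap
  obtain ⟨-, r, hr, hball⟩ := mem_relInterior_iff.1 hap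
  refine mem_relInterior_iff.2 ⟨ha, r, hr, fun v hv hvr => ?_⟩
  have := hball v (h.direction_le rfl hv) hvr
  rw [show a + p + v = a + v + p by abel] at this
  change F (a + v) < ⊤
  rw [← hP hp]
  exact this

/-- Reduces essential smoothness on the affine hull to the case of smoothness on the first summand.
-/
theorem isDirectSum_bot (Q : AffineSubspace ℝ E) :
    IsDirectSum (Q : Set E) Q ((⊥ : Submodule ℝ E) : Set E) := by
  refine ⟨?_, ?_, ?_⟩
  · rintro ⟨a, p⟩ ⟨ha, hp⟩
    have hp' : p = 0 := by simpa using hp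
    simpa [hp'] using ha
  · rintro ⟨a, p⟩ ⟨-, hp⟩ ⟨b, q⟩ ⟨-, hq⟩ hab
    have hp' : p = 0 := by simpa using hp
    have hq' : q = 0 := by simpa using hq
    subst hp' hq'
    simpa using hab
  · intro y hy
    exact ⟨(y, 0), ⟨hy, by simp⟩, by simp⟩

theorem mem_effDom_of_mem_argmin_add {F G : E → EReal} (hF : IsConvexFun F) (hG : IsConvexFun G)
    (hne : (effDom F ∩ effDom G).Nonempty) {x : E} (hx : x ∈ argmin (fun x => F x + G x)) :
    x ∈ effDom F ∧ x ∈ effDom G := by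
  obtain ⟨z, hzF, hzG⟩ := hne
  have hlt : F x + G x < ⊤ := lt_of_le_of_lt (hx z) (EReal.add_lt_top (ne_of_lt hzF) (ne_of_lt hzG))
  constructor
  · refine (lt_top_iff_ne_top (a := F x)).2 fun htop => ?_
    rw [htop, EReal.top_add_of_ne_bot (hG.1 x)] at hlt
    exact lt_irrefl _ hlt
  · refine (lt_top_iff_ne_top (a := G x)).2 fun htop => ?_
    rw [htop, EReal.add_top_of_ne_bot (hF.1 x)] at hlt
    exact lt_irrefl _ hlt

theorem toReal_add_le_of_mem_argmin {F G : E → EReal} (hF : IsConvexFun F) (hG : IsConvexFun G)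
    {x y : E} (hx : x ∈ argmin (fun x => F x + G x)) (hxF : x ∈ effDom F) (hxG : x ∈ effDom G)
    (hyF : y ∈ effDom F) (hyG : y ∈ effDom G) :
    (F x).toReal + (G x).toReal ≤ (F y).toReal + (G y).toReal := by
  have h : F x + G x ≤ F y + G y := hx y
  rw [← hF.coe_toReal hxF, ← hF.coe_toReal hyF, ← hG.coe_toReal hxG, ← hG.coe_toReal hyG] at h
  exact_mod_cast h

theorem EssentiallySmoothOn.argmin_add_subset [FiniteDimensional ℝ E] {F G : E → EReal}
    (hF : IsConvexFun F) (hG : IsConvexFun G)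
    (hri : (intrinsicInterior ℝ (effDom F) ∩ intrinsicInterior ℝ (effDom G)).Nonempty)
    {A : AffineSubspace ℝ E} {P : Submodule ℝ E} (hP : (P : Set E) ⊆ periods F)
    (h : IsDirectSum (affineSpan ℝ (effDom F) : Set E) A P) (hs : EssentiallySmoothOn F A) :
    argmin (fun x => F x + G x) ⊆ intrinsicInterior ℝ (effDom F) := by
  intro x hx
  have hne := hri.mono (inter_subset_inter intrinsicInterior_subset intrinsicInterior_subset)
  obtain ⟨hxF, hxG⟩ := mem_effDom_of_mem_argmin_add hF hG hne hx
  obtain ⟨z, hzi, hzGi⟩ := hri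
  have hzF := intrinsicInterior_subset hzi
  have hzG := intrinsicInterior_subset hzGi
  obtain ⟨⟨a, p⟩, ⟨ha, hp⟩, rfl⟩ := h.surjOn (subset_affineSpan ℝ _ hxF)
  obtain ⟨⟨b, q⟩, ⟨hb, hq⟩, rfl⟩ := h.surjOn (subset_affineSpan ℝ _ hzF)
  dsimp only at *
  have haF : a ∈ effDom F := by
    change F a < ⊤
    rw [← hP hp a]
    exact hxF
  refine add_mem_intrinsicInterior hP h ?_ hp
  refine hs.mem_relInterior hF ha haF
    (mem_relInterior_of_add_mem_intrinsicInterior hP h hb hq hzi)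
    -- The linear rate is the slope of the convexity bound for `G` on the segment.
    ((G (b + q)).toReal - (G (a + p)).toReal) fun t ht ht1 => ?_
  -- The segment in `A` and the one from the minimizer differ pointwise by periods.
  have hshift : F (a + t • (b - a)) = F ((1 - t) • (a + p) + t • (b + q)) := by
    have hmem : (1 - t) • p + t • q ∈ P := P.add_mem (P.smul_mem _ hp) (P.smul_mem _ hq)
    rw [← hP hmem]
    congr 1
    module
  rw [hshift, ← hP hp a]
  rcases ht1.eq_or_lt with rfl | hlt
  · have := toReal_add_le_of_mem_argmin hF hG hx hxF hxG hzF hzG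
    simp only [sub_self, zero_smul, zero_add, one_smul]
    linarith
  · obtain ⟨hmG, hGle⟩ := hG.combo hxG hzG (sub_pos.2 hlt) ht (by ring)
    obtain ⟨hmF, -⟩ := hF.combo hxF hzF (sub_pos.2 hlt) ht (by ring)
    have := toReal_add_le_of_mem_argmin hF hG hx hxF hxG hmF hmG
    linarith

theorem sub_mem_and_eq_of_mem_argmin_add {F G : E → EReal}
    (hF : IsConvexFun F) (hG : IsConvexFun G)
    (hne : (effDom F ∩ effDom G).Nonempty)
    {A : AffineSubspace ℝ E} {P : Submodule ℝ E} (hP : (P : Set E) ⊆ periods F)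
    (h : IsDirectSum (affineSpan ℝ (effDom F) : Set E) A P)
    (hstrict : IsStrictlyConvexOn F (relInterior A (effDom F)))
    (hsub : argmin (fun x => F x + G x) ⊆ intrinsicInterior ℝ (effDom F)) {x y : E}
    (hx : x ∈ argmin (fun x => F x + G x)) (hy : y ∈ argmin (fun x => F x + G x)) :
    x - y ∈ P ∧ F x = F y ∧ G x = G y := by
  obtain ⟨hxF, hxG⟩ := mem_effDom_of_mem_argmin_add hF hG hne hx
  obtain ⟨hyF, hyG⟩ := mem_effDom_of_mem_argmin_add hF hG hne hy
  have hxi := hsub hx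
  have hyi := hsub hy
  obtain ⟨⟨a, p⟩, ⟨ha, hp⟩, rfl⟩ := h.surjOn (subset_affineSpan ℝ _ hxF)
  obtain ⟨⟨b, q⟩, ⟨hb, hq⟩, rfl⟩ := h.surjOn (subset_affineSpan ℝ _ hyF)
  dsimp only at *
  have hxy := toReal_add_le_of_mem_argmin hF hG hx hxF hxG hyF hyG
  have hyx := toReal_add_le_of_mem_argmin hF hG hy hyF hyG hxF hxG
  have hab : a = b := by
    by_contra hne
    have h2 : (0 : ℝ) < 1 / 2 := by norm_num
    obtain ⟨hmF, -⟩ := hF.combo hxF hyF h2 h2 (by norm_num)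
    obtain ⟨hmG, hGle⟩ := hG.combo hxG hyG h2 h2 (by norm_num)
    have hlt := hstrict a (mem_relInterior_of_add_mem_intrinsicInterior hP h ha hp hxi) b
      (mem_relInterior_of_add_mem_intrinsicInterior hP h hb hq hyi) hne _ _ h2 h2 (by norm_num)
    have hshift : F ((1 / 2 : ℝ) • a + (1 / 2 : ℝ) • b) =
        F ((1 / 2 : ℝ) • (a + p) + (1 / 2 : ℝ) • (b + q)) := by
      have hmem : (1 / 2 : ℝ) • p + (1 / 2 : ℝ) • q ∈ P :=
        P.add_mem (P.smul_mem _ hp) (P.smul_mem _ hq)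
      rw [← hP hmem]
      congr 1
      module
    rw [hshift, ← hP hp a, ← hP hq b, ← hF.coe_toReal hxF, ← hF.coe_toReal hyF,
      ← hF.coe_toReal hmF] at hlt
    have hlt' : (F ((1 / 2 : ℝ) • (a + p) + (1 / 2 : ℝ) • (b + q))).toReal <
        1 / 2 * (F (a + p)).toReal + 1 / 2 * (F (b + q)).toReal := by
      exact_mod_cast hlt
    have := toReal_add_le_of_mem_argmin hF hG hx hxF hxG hmF hmG
    linarith
  subst hab
  have hFeq : F (a + p) = F (a + q) := by rw [hP hp, hP hq]
  refine ⟨by simpa using P.sub_mem hp hq, hFeq, ?_⟩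
  rw [hFeq] at hxy hyx
  rw [← hG.coe_toReal hxG, ← hG.coe_toReal hyG]
  exact congrArg _ (by linarith)

end

end ConvexArgmin

theorem mainTheorem11 (n : ℕ) (F G : EuclideanSpace ℝ (Fin n) → EReal)
    (hF : ConvexArgmin.IsConvexFun F) (hG : ConvexArgmin.IsConvexFun G)
    (hri : (intrinsicInterior ℝ (ConvexArgmin.effDom F) ∩
      intrinsicInterior ℝ (ConvexArgmin.effDom G)).Nonempty)
    (A : AffineSubspace ℝ (EuclideanSpace ℝ (Fin n)))
    (P : Submodule ℝ (EuclideanSpace ℝ (Fin n)))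
    (hP : (P : Set (EuclideanSpace ℝ (Fin n))) ⊆ ConvexArgmin.periods F)
    (hdecomp : ConvexArgmin.IsDirectSum
      (affineSpan ℝ (ConvexArgmin.effDom F) : Set (EuclideanSpace ℝ (Fin n)))
      (A : Set (EuclideanSpace ℝ (Fin n))) (P : Set (EuclideanSpace ℝ (Fin n))))
    (hsmooth : ConvexArgmin.EssentiallySmoothOn F (affineSpan ℝ (ConvexArgmin.effDom F)) ∨
      ConvexArgmin.EssentiallySmoothOn F A)
    (hstrict : ConvexArgmin.IsStrictlyConvexOn F
      (ConvexArgmin.relInterior A (ConvexArgmin.effDom F))) :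
    ConvexArgmin.argmin (fun x => F x + G x) ⊆ intrinsicInterior ℝ (ConvexArgmin.effDom F) ∧
      ∀ x ∈ ConvexArgmin.argmin (fun x => F x + G x),
        ∀ y ∈ ConvexArgmin.argmin (fun x => F x + G x),
          x - y ∈ P ∧ F x = F y ∧ G x = G y := by
  have hsub : ConvexArgmin.argmin (fun x => F x + G x) ⊆
      intrinsicInterior ℝ (ConvexArgmin.effDom F) := by
    rcases hsmooth with hs | hs
    · refine hs.argmin_add_subset hF hG hri (P := ⊥) ?_ (ConvexArgmin.isDirectSum_bot _)
      intro p hp x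
      have hp' : p = 0 := by simpa using hp
      simp [hp']
    · exact hs.argmin_add_subset hF hG hri hP hdecomp
  exact ⟨hsub, fun x hx y hy => ConvexArgmin.sub_mem_and_eq_of_mem_argmin_add hF hG
    (hri.mono (inter_subset_inter intrinsicInterior_subset intrinsicInterior_subset)) hP hdecomp
    hstrict hsub hx hy⟩
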